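/- **Theorem (a contractive Schur–Horn theorem for $B(H)$).** Let $H$ be a separable complex Hilbert space with a fixed orthonormal basis $(e_i)_{i\in\mathbb N}$. For $f\in\ell^\infty(\mathbb N)$ let $M_f\in B(H)$ be the diagonal operator with $M_fe_i=f_ie_i$ for all $i$, and let $P_D:B(H)\to B(H)$ be the trace preserving conditional expectation onto the algebra of diagonal operators, $P_D(x)=M_f$ with $f_i=\langle x e_i,e_i\rangle$. For $k\in\mathbb N$ and self-adjoint $a\in B(H)$ put $$U_k(a)=\sup\{\operatorname{Tr}(ap):\ p\in B(H)\text{ an orthogonal projection with }\operatorname{Tr}(p)=k\},$$ and for self-adjoint $a,b$ write $a\prec_w b$ ($a$ is submajorized by $b$) if $U_k(a)\le U_k(b)$ for every $k\in\mathbb N$. Then for every positive $b\in B(H)$, $$\overline{\{P_D(v\,b\,v^*):\ v\in B(H),\ v^*v\le I\}}^{\,\|\cdot\|}=\{M_f:\ f\in\ell^\infty(\mathbb N),\ f_i\ge 0\text{ for all }i,\ M_f\prec_w b\},$$ where the closure is taken in the operator norm. -/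

import Mathlib

open scoped ENNReal ComplexOrder

noncomputable section

namespace ContractiveSchurHorn

variable {H : Type*} [NormedAddCommGroup H] [InnerProductSpace ℂ H]

/-- The operator `x` is trace class with canonical trace `Tr x = t`: for every orthonormal
basis `(u_i)` of `H` the series `∑ ⟨x u_i, u_i⟩` converges unconditionally with sum `t`.
It is meant for infinite-dimensional separable `H`, whose orthonormal bases are indexed by `ℕ`;
Mathlib's inner product is linear in its second variable. -/
def HasTrace (x : H →L[ℂ] H) (t : ℂ) : Prop :=
  ∀ u : HilbertBasis ℕ ℂ H, HasSum (fun i => inner ℂ (u i) (x (u i))) t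

/-- The set of orthogonal projections `p` in `B(H)` with `Tr p = k`. -/
def projections [CompleteSpace H] (k : ℕ) : Set (H →L[ℂ] H) :=
  {p | IsStarProjection p ∧ HasTrace p k}

/-- `U_k(b) = sup {Tr (b p) : p an orthogonal projection with Tr p = k}`, for `b` self-adjoint
(the numbers `Tr (b p)` are then real and bounded by `k ‖b‖`). -/
def upperSum [CompleteSpace H] (k : ℕ) (b : H →L[ℂ] H) : ℝ :=
  sSup {t : ℝ | ∃ p ∈ projections (H := H) k, HasTrace (b * p) t}

/-- Submajorization `a ≺_w b` of self-adjoint operators. -/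
def Submajorized [CompleteSpace H] (a b : H →L[ℂ] H) : Prop :=
  ∀ k : ℕ, upperSum k a ≤ upperSum k b

/-- The contractions `v` in `B(H)`, that is, `v* v ≤ 1`. -/
def contractions (H : Type*) [NormedAddCommGroup H] [InnerProductSpace ℂ H] [CompleteSpace H] :
    Set (H →L[ℂ] H) :=
  {v | star v * v ≤ 1}

/-- A bounded sequence times a square-summable one is square-summable. -/
theorem memlp_mul (f : lp (fun _ : ℕ => ℂ) ∞) (x : lp (fun _ : ℕ => ℂ) 2) :
    Memℓp (fun i => f i * x i) 2 := by
  refine (lp.memℓp ((‖f‖ : ℂ) • x)).mono' (fun i => ?_)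
  simp only [lp.coeFn_smul, Pi.smul_apply, smul_eq_mul, norm_mul, Complex.norm_real, norm_norm]
  exact mul_le_mul_of_nonneg_right (lp.norm_apply_le_norm (by simp) f i) (norm_nonneg _)

/-- Multiplication by a bounded sequence on `ℓ²(ℕ)`. -/
def mulOp (f : lp (fun _ : ℕ => ℂ) ∞) :
    lp (fun _ : ℕ => ℂ) 2 →L[ℂ] lp (fun _ : ℕ => ℂ) 2 :=
  LinearMap.mkContinuous
    { toFun := fun x => ⟨fun i => f i * x i, memlp_mul f x⟩
      map_add' := fun x y => by ext i; exact mul_add _ _ _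
      map_smul' := fun c x => by ext i; exact mul_left_comm _ _ _ }
    ‖f‖ (fun x => by
      have h : ‖(⟨fun i => f i * x i, memlp_mul f x⟩ : lp (fun _ : ℕ => ℂ) 2)‖
          ≤ ‖(‖f‖ : ℂ) • x‖ := by
        refine lp.norm_mono (by simp) (fun i => ?_)
        simp only [lp.coeFn_smul, Pi.smul_apply, smul_eq_mul, norm_mul, Complex.norm_real,
          norm_norm]
        exact mul_le_mul_of_nonneg_right (lp.norm_apply_le_norm (by simp) f i) (norm_nonneg _)
      rw [lp.norm_const_smul (by simp), Complex.norm_real, norm_norm] at h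
      exact h)

/-- The diagonal operator `M_f = ∑ f_i e_{ii}` with respect to the orthonormal basis `e`:
the operator that multiplies the `i`-th coordinate with respect to `e` by `f i`. -/
def diagOp (e : HilbertBasis ℕ ℂ H) (f : lp (fun _ : ℕ => ℂ) ∞) : H →L[ℂ] H :=
  (e.repr.symm.toContinuousLinearEquiv : lp (fun _ : ℕ => ℂ) 2 →L[ℂ] H) ∘L
    mulOp f ∘L (e.repr.toContinuousLinearEquiv : H →L[ℂ] lp (fun _ : ℕ => ℂ) 2)

theorem diagOp_apply_basis (e : HilbertBasis ℕ ℂ H) (f : lp (fun _ : ℕ => ℂ) ∞) (i : ℕ) :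
    diagOp e f (e i) = f i • e i := by
  classical
  apply e.repr.injective
  ext j
  by_cases h : j = i
  · subst h
    simp [diagOp, mulOp]
  · have h0 : (lp.single 2 i (1 : ℂ) : lp (fun _ : ℕ => ℂ) 2) j = 0 := lp.single_apply_ne _ _ _ h
    have h1 : e.repr (e i) j = 0 := by rw [e.repr_self]; exact h0
    simp [diagOp, mulOp, h1]

/-- The diagonal `(⟨x e_i, e_i⟩)_i` of a bounded operator `x`, as a bounded sequence. -/
def diagSeq (e : HilbertBasis ℕ ℂ H) (x : H →L[ℂ] H) : lp (fun _ : ℕ => ℂ) ∞ :=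
  ⟨fun i => inner ℂ (e i) (x (e i)), memℓp_infty ⟨‖x‖, by
    rintro _ ⟨i, rfl⟩
    have h1 : ‖e i‖ = 1 := e.orthonormal.1 i
    calc ‖inner ℂ (e i) (x (e i))‖ ≤ ‖e i‖ * ‖x (e i)‖ := norm_inner_le_norm _ _
      _ ≤ ‖x‖ := by simpa [h1] using x.le_opNorm (e i)⟩⟩

/-- The trace preserving conditional expectation `P_D(x) = ∑ e_{ii} x e_{ii}` of `B(H)` onto the
diagonal operators with respect to `e`. -/
def diagExp (e : HilbertBasis ℕ ℂ H) (x : H →L[ℂ] H) : H →L[ℂ] H :=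
  diagOp e (diagSeq e x)

end ContractiveSchurHorn

end

namespace ContractiveSchurHorn

/-! ### Finite rearrangement -/

/-! Everything is phrased through the quadratic form `energy b`. The `i`-th diagonal entry of `v b
v*` is its value at `v* e_i`. Projections of trace `k` are the sums of rank-one projections over
orthonormal `k`-tuples, so `U_k(b)` is the supremum of the sums of the form over such tuples
(`exists_projection_hasTrace_iff`).

For `⊆`, compress `b` to a finite-dimensional space containing the vectors `v* e_i`, `i ∈ S`, and
diagonalize there. By Bessel, the sum of the form over these vectors is a combination of eigenvalues
with weights in `[0, 1]` of total mass at most `|S|`, hence at most a sum of `|S|` eigenvalues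
(`sum_energy_star_le_upperSum`). The right-hand side is norm closed, being cut out by continuous
conditions on matrix entries.

For `⊇`, it is enough to find an orthonormal sequence `u_i` on which the form is at least `f_i - ε`;
shrinking the `u_i` then corrects the excess. Let `α` be the essential maximum of `b`. Since
`U_m(b)` grows asymptotically at rate at most `α`, only finitely many `f_i` exceed `α` by a fixed
amount. These are served by Horn's theorem in a finite-dimensional compression
(`exists_orthonormalFinset_sub_le_energy`). The others are served by vectors chosen successively in
orthogonal complements of finite-dimensional spaces, where values close to `α` always remain
available. -/

/-- A finite set has a subset of prescribed size on which `f` is largest. -/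
theorem exists_top_subset {ι : Type*} [DecidableEq ι] (G : Finset ι) (f : ι → ℝ)
    (hf : ∀ i ∈ G, 0 ≤ f i) (m : ℕ) (hm : m ≤ G.card) :
    ∃ T ⊆ G, T.card = m ∧ ∃ t : ℝ, 0 ≤ t ∧ (∀ j ∈ T, t ≤ f j) ∧ ∀ i ∈ G \ T, f i ≤ t := by
  induction m with
  | zero =>
    -- For the empty set the threshold only has to bound `f` on `G`; the total sum does.
    refine ⟨∅, by simp, by simp, ∑ i ∈ G, f i, Finset.sum_nonneg hf, by simp, fun i hi => ?_⟩
    exact Finset.single_le_sum hf (by simpa using hi)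
  | succ m ih =>
    obtain ⟨T, hTG, hT, t, -, h1, h2⟩ := ih (by omega)
    have hne : (G \ T).Nonempty := by
      rw [← Finset.card_pos, Finset.card_sdiff_of_subset hTG]
      omega
    obtain ⟨j, hj, hmax⟩ := Finset.exists_max_image (G \ T) f hne
    have hj' := Finset.mem_sdiff.1 hj
    refine ⟨insert j T, Finset.insert_subset hj'.1 hTG, by rw [Finset.card_insert_of_notMem hj'.2, hT],
      f j, hf j hj'.1, ?_, ?_⟩
    · intro i hi
      rcases Finset.mem_insert.1 hi with rfl | hi
      · exact le_rfl
      · exact (h2 j hj).trans (h1 i hi)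
    · intro i hi
      refine hmax i ?_
      simp only [Finset.mem_sdiff, Finset.mem_insert, not_or] at hi ⊢
      exact ⟨hi.1, hi.2.2⟩

/-- A weighted sum with weights in `[0, 1]` of total mass at most `m` is dominated by the sum over
some subset of size `m`. -/
theorem exists_subset_sum_mul_le {ι : Type*} [DecidableEq ι] (G : Finset ι) (c f : ι → ℝ)
    (hf : ∀ i ∈ G, 0 ≤ f i) (hc0 : ∀ i ∈ G, 0 ≤ c i) (hc1 : ∀ i ∈ G, c i ≤ 1) (m : ℕ)
    (hm : m ≤ G.card) (hc : ∑ i ∈ G, c i ≤ m) :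
    ∃ T ⊆ G, T.card = m ∧ ∑ i ∈ G, c i * f i ≤ ∑ i ∈ T, f i := by
  obtain ⟨T, hTG, hT, t, ht, h1, h2⟩ := exists_top_subset G f hf m hm
  refine ⟨T, hTG, hT, ?_⟩
  -- Centering at the threshold `t` makes `f - t` nonnegative on `T` and nonpositive off it, so the
  -- optimal weights are the indicator of `T`. The mass bound enters through `0 ≤ t`.
  have e1 : ∑ i ∈ G, c i * f i = ∑ i ∈ G, c i * (f i - t) + (∑ i ∈ G, c i) * t := by
    rw [Finset.sum_mul, ← Finset.sum_add_distrib]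
    exact Finset.sum_congr rfl fun i _ => by ring
  have e2 : ∑ i ∈ T, f i = ∑ i ∈ T, (f i - t) + m * t := by
    simp [Finset.sum_sub_distrib, hT]
  have e3 : ∑ i ∈ G, c i * (f i - t) ≤ ∑ i ∈ T, (f i - t) := by
    rw [← Finset.sum_sdiff hTG]
    have n1 : ∑ i ∈ G \ T, c i * (f i - t) ≤ 0 := Finset.sum_nonpos fun i hi =>
      mul_nonpos_of_nonneg_of_nonpos (hc0 i (Finset.mem_sdiff.1 hi).1) (by linarith [h2 i hi])
    have n2 : ∑ i ∈ T, c i * (f i - t) ≤ ∑ i ∈ T, (f i - t) := Finset.sum_le_sum fun i hi =>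
      mul_le_of_le_one_left (by linarith [h1 i hi]) (hc1 i (hTG hi))
    linarith
  have e4 : (∑ i ∈ G, c i) * t ≤ m * t := mul_le_mul_of_nonneg_right hc ht
  linarith

/-- If `T` has an element outside `A`, and `j` dominates all elements outside `A`, then `T` can be
modified into a set of the same size and larger sum that contains `j` and everything in `T ∩ A`. -/
theorem exists_exchange {ι : Type*} [DecidableEq ι] (Λ A T : Finset ι) (f : ι → ℝ) (j : ι)
    (hT : T ⊆ Λ) (hj : j ∈ Λ) (hA : A.card < T.card) (hmax : ∀ i ∈ Λ, i ∉ A → f i ≤ f j) :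
    ∃ T' ⊆ Λ, T'.card = T.card ∧ j ∈ T' ∧ T ∩ A ⊆ T' ∧ ∑ i ∈ T, f i ≤ ∑ i ∈ T', f i := by
  by_cases hjT : j ∈ T
  · exact ⟨T, hT, rfl, hjT, Finset.inter_subset_left, le_rfl⟩
  obtain ⟨i, hi, hiA⟩ := Finset.exists_mem_notMem_of_card_lt_card hA
  have hje : j ∉ T.erase i := fun h => hjT (Finset.mem_of_mem_erase h)
  refine ⟨insert j (T.erase i), Finset.insert_subset hj ((Finset.erase_subset _ _).trans hT), ?_,
    Finset.mem_insert_self _ _, ?_, ?_⟩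
  · rw [Finset.card_insert_of_notMem hje, Finset.card_erase_add_one hi]
  · intro l hl
    rw [Finset.mem_inter] at hl
    refine Finset.mem_insert_of_mem (Finset.mem_erase.2 ⟨?_, hl.1⟩)
    rintro rfl
    exact hiA hl.2
  · rw [Finset.sum_insert hje, ← Finset.add_sum_erase T f hi]
    linarith [hmax i (hT hi) hiA]

/-- The combinatorial step in Horn's theorem: splitting off the largest entry `f₀` of `f` and
replacing two entries `a ≥ f₀ > c` of `g` by `a + c - f₀` preserves submajorization. -/
theorem exists_subset_sum_le_update {ι κ : Type*} [DecidableEq ι] [DecidableEq κ]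
    {F : Finset ι} {f : ι → ℝ} {Λ : Finset κ} {g : κ → ℝ}
    (hfg : ∀ S ⊆ F, ∃ T ⊆ Λ, T.card = S.card ∧ ∑ i ∈ S, f i ≤ ∑ j ∈ T, g j)
    {i₀ : ι} (hi₀ : i₀ ∈ F) (hmax : ∀ i ∈ F, f i ≤ f i₀) {j₁ j₂ : κ} (hj₁ : j₁ ∈ Λ) (hj₂ : j₂ ∈ Λ)
    (h₁ : f i₀ ≤ g j₁) (h₂ : g j₂ < f i₀) (hmax₂ : ∀ j ∈ Λ, g j < f i₀ → g j ≤ g j₂)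
    {S : Finset ι} (hS : S ⊆ F.erase i₀) :
    ∃ T ⊆ Λ.erase j₂, T.card = S.card ∧
      ∑ i ∈ S, f i ≤ ∑ j ∈ T, Function.update g j₁ (g j₁ + g j₂ - f i₀) j := by
  have hj : j₁ ≠ j₂ := by rintro rfl; linarith
  set A := Λ.filter fun j => f i₀ ≤ g j with hA
  have hj₁A : j₁ ∈ A := by simp [hA, hj₁, h₁]
  have hi₀S : i₀ ∉ S := fun h => by simpa using hS h
  -- If `A` has a spare element besides `j₁`, any `|S|` of the others suffice, as their values are
  -- at least every `f i`. Otherwise `insert i₀ S` is larger than `A`, so its dominating set can be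
  -- exchanged to contain both `j₁` and `j₂`; erasing `j₂` then pays for `f i₀`.
  rcases Nat.lt_or_ge S.card A.card with hlt | hge
  · obtain ⟨T, hTA, hT⟩ := Finset.exists_subset_card_eq
      (show S.card ≤ (A.erase j₁).card by rw [Finset.card_erase_of_mem hj₁A]; omega)
    refine ⟨T, ?_, hT, ?_⟩
    · intro j hjT
      have h3 := Finset.mem_erase.1 (hTA hjT)
      have h4 := (Finset.mem_filter.1 h3.2)
      refine Finset.mem_erase.2 ⟨?_, h4.1⟩
      rintro rfl
      linarith [h4.2]
    · calc ∑ i ∈ S, f i ≤ S.card • f i₀ :=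
            Finset.sum_le_card_nsmul _ _ _ fun i hi => hmax i (Finset.mem_of_mem_erase (hS hi))
        _ = T.card • f i₀ := by rw [hT]
        _ ≤ _ := Finset.card_nsmul_le_sum _ _ _ fun j hjT => by
            have h3 := Finset.mem_erase.1 (hTA hjT)
            rw [Function.update_of_ne h3.1]
            exact (Finset.mem_filter.1 h3.2).2
  · obtain ⟨T, hTΛ, hT, hsum⟩ := hfg (insert i₀ S)
      (Finset.insert_subset hi₀ (hS.trans (Finset.erase_subset _ _)))
    rw [Finset.card_insert_of_notMem hi₀S] at hT
    rw [Finset.sum_insert hi₀S] at hsum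
    obtain ⟨T₁, hT₁Λ, hT₁, hj₁T₁, -, hs₁⟩ := exists_exchange Λ A T g j₁ hTΛ hj₁ (by omega)
      (fun i hi hiA => by
        have : ¬ f i₀ ≤ g i := fun h => hiA (by simp [hA, hi, h])
        linarith)
    obtain ⟨T₂, hT₂Λ, hT₂, hj₂T₂, hsub, hs₂⟩ := exists_exchange Λ A T₁ g j₂ hT₁Λ hj₂ (by omega)
      (fun i hi hiA => by
        have : ¬ f i₀ ≤ g i := fun h => hiA (by simp [hA, hi, h])
        exact hmax₂ i hi (by linarith))
    have hj₁T₂ : j₁ ∈ T₂ := hsub (Finset.mem_inter.2 ⟨hj₁T₁, hj₁A⟩)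
    have hj₁E : j₁ ∈ T₂.erase j₂ := Finset.mem_erase.2 ⟨hj, hj₁T₂⟩
    refine ⟨T₂.erase j₂, Finset.erase_subset_erase _ hT₂Λ, ?_, ?_⟩
    · rw [Finset.card_erase_of_mem hj₂T₂]; omega
    · rw [Finset.sum_update_of_mem hj₁E]
      have e1 := Finset.add_sum_erase T₂ g hj₂T₂
      have e2 := Finset.add_sum_erase _ g hj₁E
      rw [Finset.sdiff_singleton_eq_erase]
      linarith

variable {H : Type*} [NormedAddCommGroup H] [InnerProductSpace ℂ H]

/-! ### The quadratic form of an operator and Horn's theorem -/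

/-- The real quadratic form `x ↦ Re ⟨b x, x⟩`. -/
noncomputable def energy (b : H →L[ℂ] H) (x : H) : ℝ := (inner ℂ x (b x)).re

theorem energy_smul (b : H →L[ℂ] H) (c : ℝ) (x : H) :
    energy b ((c : ℂ) • x) = c ^ 2 * energy b x := by
  simp only [energy, map_smul, inner_smul_left, inner_smul_right, Complex.conj_ofReal,
    Complex.re_ofReal_mul]
  ring

theorem energy_add_of_inner_eq_zero {b : H →L[ℂ] H} {x y : H} (h₁ : inner ℂ x (b y) = 0)
    (h₂ : inner ℂ y (b x) = 0) : energy b (x + y) = energy b x + energy b y := by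
  simp [energy, h₁, h₂]

theorem energy_smul_add_smul {b : H →L[ℂ] H} {x y : H} (h₁ : inner ℂ x (b y) = 0)
    (h₂ : inner ℂ y (b x) = 0) (s t : ℝ) :
    energy b ((s : ℂ) • x + (t : ℂ) • y) = s ^ 2 * energy b x + t ^ 2 * energy b y := by
  rw [energy_add_of_inner_eq_zero, energy_smul, energy_smul] <;>
    simp [h₁, h₂]

theorem norm_smul_add_smul_eq_one {x y : H} (hx : ‖x‖ = 1) (hy : ‖y‖ = 1) (h : inner ℂ x y = 0)
    {s t : ℝ} (hst : s ^ 2 + t ^ 2 = 1) : ‖(s : ℂ) • x + (t : ℂ) • y‖ = 1 := by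
  have h2 := norm_add_sq_eq_norm_sq_add_norm_sq_of_inner_eq_zero (𝕜 := ℂ) ((s : ℂ) • x)
    ((t : ℂ) • y) (by simp [h])
  simp only [norm_smul, hx, hy, Complex.norm_real, mul_one, Real.norm_eq_abs, abs_mul_abs_self] at h2
  nlinarith [norm_nonneg ((s : ℂ) • x + (t : ℂ) • y)]

theorem inner_eq_zero_of_mem_span {s : Set H} {w x : H} (hw : ∀ y ∈ s, inner ℂ w y = 0)
    (hx : x ∈ Submodule.span ℂ s) : inner ℂ w x = 0 := by
  induction hx using Submodule.span_induction with
  | mem y hy => exact hw y hy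
  | zero => simp
  | add y z _ _ h1 h2 => simp [h1, h2]
  | smul c y _ h1 => simp [h1]

/-- A family is orthonormal on a finset. -/
def OrthonormalFinset {ι : Type*} (s : Finset ι) (u : ι → H) : Prop :=
  (∀ i ∈ s, ‖u i‖ = 1) ∧ ∀ i ∈ s, ∀ j ∈ s, i ≠ j → inner ℂ (u i) (u j) = 0

/-- **Horn's theorem**, in the weak form: if the numbers `f i` are submajorized by the diagonal
entries of `b` in a finite orthonormal system that diagonalizes `b`, there is an orthonormal system
in its span on which the quadratic form of `b` dominates `f`. -/
theorem exists_orthonormalFinset_le_energy [CompleteSpace H] {ι κ : Type*} [DecidableEq ι]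
    [DecidableEq κ]
    {b : H →L[ℂ] H} (hb : IsSelfAdjoint b) (f : ι → ℝ) (n : ℕ) :
    ∀ (F : Finset ι) (Λ : Finset κ) (ψ : κ → H), F.card = n → F.card ≤ Λ.card →
      OrthonormalFinset Λ ψ → (∀ i ∈ Λ, ∀ j ∈ Λ, i ≠ j → inner ℂ (ψ i) (b (ψ j)) = 0) →
      (∀ S ⊆ F, ∃ T ⊆ Λ, T.card = S.card ∧ ∑ i ∈ S, f i ≤ ∑ j ∈ T, energy b (ψ j)) →
      ∃ u : ι → H, (∀ i ∈ F, u i ∈ Submodule.span ℂ (ψ '' Λ)) ∧ OrthonormalFinset F u ∧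
        ∀ i ∈ F, f i ≤ energy b (u i) := by
  induction n with
  | zero =>
    intro F Λ ψ hF _ _ _ _
    obtain rfl := Finset.card_eq_zero.1 hF
    exact ⟨0, by simp, by simp [OrthonormalFinset], by simp⟩
  | succ n ih =>
    intro F Λ ψ hF hcard hψ hbψ hfg
    obtain ⟨i₀, hi₀, hmax⟩ := Finset.exists_max_image F f (Finset.card_pos.1 (by omega))
    have hFe : (F.erase i₀).card = n := by rw [Finset.card_erase_of_mem hi₀]; omega
    -- it suffices to split off a vector for `i₀`
    suffices step : ∃ (w : H) (Λ' : Finset κ) (ψ' : κ → H), w ∈ Submodule.span ℂ (ψ '' Λ) ∧ ‖w‖ = 1 ∧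
        f i₀ ≤ energy b w ∧ n ≤ Λ'.card ∧ (∀ j ∈ Λ', ψ' j ∈ Submodule.span ℂ (ψ '' Λ)) ∧
        (∀ j ∈ Λ', inner ℂ w (ψ' j) = 0) ∧ OrthonormalFinset Λ' ψ' ∧
        (∀ i ∈ Λ', ∀ j ∈ Λ', i ≠ j → inner ℂ (ψ' i) (b (ψ' j)) = 0) ∧
        ∀ S ⊆ F.erase i₀, ∃ T ⊆ Λ', T.card = S.card ∧
          ∑ i ∈ S, f i ≤ ∑ j ∈ T, energy b (ψ' j) by
      obtain ⟨w, Λ', ψ', hw, hw1, hfw, hc, hsp, hort, hψ', hbψ', hfg'⟩ := step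
      obtain ⟨u, hu1, hu2, hu3⟩ := ih (F.erase i₀) Λ' ψ' hFe (by omega) hψ' hbψ' hfg'
      have hle : Submodule.span ℂ (ψ' '' Λ') ≤ Submodule.span ℂ (ψ '' Λ) := by
        rw [Submodule.span_le]
        rintro _ ⟨j, hj, rfl⟩
        exact hsp j hj
      have hwu : ∀ i ∈ F.erase i₀, inner ℂ w (u i) = 0 := fun i hi =>
        inner_eq_zero_of_mem_span (by rintro _ ⟨j, hj, rfl⟩; exact hort j hj) (hu1 i hi)
      have hcase : ∀ i ∈ F, i = i₀ ∨ (i ≠ i₀ ∧ i ∈ F.erase i₀) := fun i hi => by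
        by_cases h : i = i₀
        · exact Or.inl h
        · exact Or.inr ⟨h, Finset.mem_erase.2 ⟨h, hi⟩⟩
      refine ⟨Function.update u i₀ w, fun i hi => ?_, ⟨fun i hi => ?_, fun i hi j hj hij => ?_⟩,
        fun i hi => ?_⟩
      · rcases hcase i hi with rfl | ⟨h, h'⟩
        · simpa using hw
        · simpa [h] using hle (hu1 i h')
      · rcases hcase i hi with rfl | ⟨h, h'⟩
        · simpa using hw1
        · simpa [h] using hu2.1 i h'
      · rcases hcase i hi with rfl | ⟨h, h'⟩ <;> rcases hcase j hj with rfl | ⟨k, k'⟩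
        · exact absurd rfl hij
        · simpa [k] using hwu j k'
        · simpa [h] using inner_eq_zero_symm.1 (hwu i h')
        · simpa [h, k] using hu2.2 i h' j k' hij
      · rcases hcase i hi with rfl | ⟨h, h'⟩
        · simpa using hfw
        · simpa [h] using hu3 i h'
    have hmem : ∀ j ∈ Λ, ψ j ∈ Submodule.span ℂ (ψ '' Λ) := fun j hj =>
      Submodule.subset_span ⟨j, hj, rfl⟩
    -- When no diagonal entry lies below the maximum of `f`, any basis vector may be split off.
    by_cases hsmall : ∀ j ∈ Λ, f i₀ ≤ energy b (ψ j)
    · obtain ⟨j₀, hj₀⟩ := Finset.card_pos.1 (show 0 < Λ.card by omega)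
      refine ⟨ψ j₀, Λ.erase j₀, ψ, hmem j₀ hj₀, hψ.1 j₀ hj₀, hsmall j₀ hj₀,
        by rw [Finset.card_erase_of_mem hj₀]; omega, fun j hj => hmem j (Finset.mem_of_mem_erase hj),
        fun j hj => ?_, ⟨fun i hi => hψ.1 i (Finset.mem_of_mem_erase hi), fun i hi j hj =>
          hψ.2 i (Finset.mem_of_mem_erase hi) j (Finset.mem_of_mem_erase hj)⟩,
        fun i hi j hj => hbψ i (Finset.mem_of_mem_erase hi) j (Finset.mem_of_mem_erase hj), ?_⟩
      · have h := Finset.mem_erase.1 hj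
        exact hψ.2 _ hj₀ _ h.2 h.1.symm
      · intro S hS
        obtain ⟨T, hTΛ, hT⟩ := Finset.exists_subset_card_eq (show S.card ≤ (Λ.erase j₀).card by
          rw [Finset.card_erase_of_mem hj₀]
          have := Finset.card_le_card hS
          omega)
        refine ⟨T, hTΛ, hT, ?_⟩
        calc ∑ i ∈ S, f i ≤ S.card • f i₀ :=
              Finset.sum_le_card_nsmul _ _ _ fun i hi => hmax i (Finset.mem_of_mem_erase (hS hi))
          _ = T.card • f i₀ := by rw [hT]
          _ ≤ _ := Finset.card_nsmul_le_sum _ _ _ fun j hjT =>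
              hsmall j (Finset.mem_of_mem_erase (hTΛ hjT))
    · push Not at hsmall
      obtain ⟨j₂, hj₂', hmax₂⟩ := Finset.exists_max_image (Λ.filter fun j => energy b (ψ j) < f i₀)
        (fun j => energy b (ψ j)) (by
          obtain ⟨j, hj, h⟩ := hsmall
          exact ⟨j, by simp [hj, h]⟩)
      obtain ⟨hj₂, h₂⟩ := Finset.mem_filter.1 hj₂'
      obtain ⟨j₁, hj₁, h₁⟩ : ∃ j ∈ Λ, f i₀ ≤ energy b (ψ j) := by
        obtain ⟨T, hTΛ, hT, h⟩ := hfg {i₀} (by simpa using hi₀)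
        obtain ⟨j, rfl⟩ := Finset.card_eq_one.1 (hT.trans (by simp))
        exact ⟨j, by simpa using hTΛ, by simpa using h⟩
      have hne : j₁ ≠ j₂ := by rintro rfl; linarith
      set a := energy b (ψ j₁) with ha
      set c := energy b (ψ j₂) with hc
      have hac : 0 < a - c := by linarith
      -- The solution of `t a + (1 - t) c = f i₀`: rotating by this amount gives `w` the value `f
      -- i₀` exactly, and leaves `a + c - f i₀` to `w'`.
      set t : ℝ := (f i₀ - c) / (a - c) with ht
      have hta : t * (a - c) = f i₀ - c := div_mul_cancel₀ _ hac.ne'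
      have ht0 : 0 ≤ t := div_nonneg (by linarith) hac.le
      have ht1 : t ≤ 1 := (div_le_one hac).2 (by linarith)
      have hs1 : √t ^ 2 = t := Real.sq_sqrt ht0
      have hs2 : √(1 - t) ^ 2 = 1 - t := Real.sq_sqrt (by linarith)
      have o12 := hψ.2 j₁ hj₁ j₂ hj₂ hne
      have o21 := hψ.2 j₂ hj₂ j₁ hj₁ hne.symm
      have b12 := hbψ j₁ hj₁ j₂ hj₂ hne
      have b21 := hbψ j₂ hj₂ j₁ hj₁ hne.symm
      set w : H := ((√t : ℝ) : ℂ) • ψ j₁ + ((√(1 - t) : ℝ) : ℂ) • ψ j₂ with hw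
      -- In general `b` is not diagonal in the pair `w`, `w'`. This is harmless: `w` leaves the
      -- system, and `w'` is still decoupled from the other `ψ j`.
      set w' : H := ((√(1 - t) : ℝ) : ℂ) • ψ j₁ + ((-√t : ℝ) : ℂ) • ψ j₂ with hw'
      have hww' : inner ℂ w w' = 0 := by
        simp only [hw, hw', inner_add_left, inner_add_right, inner_smul_left, inner_smul_right, o12,
          o21, inner_self_eq_norm_sq_to_K, hψ.1 j₁ hj₁, hψ.1 j₂ hj₂, Complex.conj_ofReal]
        push_cast
        ring
      have hEw : energy b w = f i₀ := by
        rw [hw, energy_smul_add_smul b12 b21, hs1, hs2, ← ha, ← hc]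
        linarith
      have hEw' : energy b w' = a + c - f i₀ := by
        rw [hw', energy_smul_add_smul b12 b21, neg_sq, hs1, hs2, ← ha, ← hc]
        linarith
      have hcase : ∀ j ∈ Λ.erase j₂, j = j₁ ∨ (j ≠ j₁ ∧ j ≠ j₂ ∧ j ∈ Λ) := fun j hj => by
        have h := Finset.mem_erase.1 hj
        by_cases h' : j = j₁
        · exact Or.inl h'
        · exact Or.inr ⟨h', h⟩
      have hsp : ∀ s t : ℝ, (s : ℂ) • ψ j₁ + (t : ℂ) • ψ j₂ ∈ Submodule.span ℂ (ψ '' Λ) := fun s t =>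
        Submodule.add_mem _ (Submodule.smul_mem _ _ (hmem j₁ hj₁))
          (Submodule.smul_mem _ _ (hmem j₂ hj₂))
      have hob : ∀ x y : H, inner ℂ x (b y) = 0 → inner ℂ y (b x) = 0 := fun x y h => by
        rw [← inner_eq_zero_symm]
        have := (ContinuousLinearMap.isSelfAdjoint_iff_isSymmetric.1 hb) x y
        rw [← h]; exact this
      refine ⟨w, Λ.erase j₂, Function.update ψ j₁ w', hsp _ _,
        norm_smul_add_smul_eq_one (hψ.1 _ hj₁) (hψ.1 _ hj₂) o12 (by rw [hs1, hs2]; ring), hEw.ge,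
        by rw [Finset.card_erase_of_mem hj₂]; omega, fun j hj => ?_, fun j hj => ?_,
        ⟨fun j hj => ?_, fun i hi j hj hij => ?_⟩, fun i hi j hj hij => ?_, fun S hS => ?_⟩
      · rcases hcase j hj with rfl | ⟨h, -, h'⟩
        · rw [Function.update_self]
          exact hsp _ _
        · simpa [h] using hmem j h'
      · rcases hcase j hj with rfl | ⟨h, h2, h'⟩
        · rwa [Function.update_self]
        · simp [h, hw, hψ.2 j₁ hj₁ j h' (Ne.symm h),
            hψ.2 j₂ hj₂ j h' (Ne.symm h2)]
      · rcases hcase j hj with rfl | ⟨h, h2, h'⟩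
        · rw [Function.update_self]
          exact norm_smul_add_smul_eq_one (hψ.1 _ hj₁) (hψ.1 _ hj₂) o12
            (s := √(1 - t)) (t := -√t) (by rw [neg_sq, hs1, hs2]; ring)
        · simpa [h] using hψ.1 j h'
      · have key : ∀ j, j ≠ j₁ → j ≠ j₂ → j ∈ Λ → inner ℂ w' (ψ j) = 0 := fun j h h2 h' => by
          simp [hw', hψ.2 j₁ hj₁ j h' (Ne.symm h),
            hψ.2 j₂ hj₂ j h' (Ne.symm h2)]
        rcases hcase i hi with rfl | ⟨h, h2, h'⟩ <;> rcases hcase j hj with rfl | ⟨k, k2, k'⟩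
        · exact absurd rfl hij
        · simpa [k] using key j k k2 k'
        · simpa [h] using inner_eq_zero_symm.1 (key i h h2 h')
        · simpa [h, k] using hψ.2 i h' j k' hij
      · have key : ∀ j, j ≠ j₁ → j ≠ j₂ → j ∈ Λ → inner ℂ w' (b (ψ j)) = 0 := fun j h h2 h' => by
          simp [hw', hbψ j₁ hj₁ j h' (Ne.symm h),
            hbψ j₂ hj₂ j h' (Ne.symm h2)]
        rcases hcase i hi with rfl | ⟨h, h2, h'⟩ <;> rcases hcase j hj with rfl | ⟨k, k2, k'⟩
        · exact absurd rfl hij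
        · simpa [k] using key j k k2 k'
        · simpa [h] using hob _ _ (key i h h2 h')
        · simpa [h, k] using hbψ i h' j k' hij
      · obtain ⟨T, hTΛ, hT, hs⟩ := exists_subset_sum_le_update hfg hi₀ hmax hj₁ hj₂ h₁ h₂
          (fun j hj h => hmax₂ j (Finset.mem_filter.2 ⟨hj, h⟩)) hS
        refine ⟨T, hTΛ, hT, hs.trans (Finset.sum_le_sum fun j _ => ?_)⟩
        by_cases h : j = j₁
        · subst h
          simp [hEw', ha, hc]
        · simp [h]

theorem energy_nonneg {b : H →L[ℂ] H} (hb : 0 ≤ b) (x : H) : 0 ≤ energy b x := by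
  have h := ((ContinuousLinearMap.nonneg_iff_isPositive b).1 hb).inner_nonneg_right x
  exact (Complex.nonneg_iff.1 h).1

theorem energy_le (b : H →L[ℂ] H) {x : H} (hx : ‖x‖ ≤ 1) : energy b x ≤ ‖b‖ := by
  calc energy b x ≤ ‖inner ℂ x (b x)‖ := Complex.re_le_norm _
    _ ≤ ‖x‖ * ‖b x‖ := norm_inner_le_norm _ _
    _ ≤ 1 * (‖b‖ * 1) := by
        gcongr
        exact (b.le_opNorm x).trans (by gcongr)
    _ = ‖b‖ := by ring

theorem inner_mul_inner_symm (x y : H) :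
    inner ℂ x y * inner ℂ y x = ((‖inner ℂ y x‖ ^ 2 : ℝ) : ℂ) := by
  rw [← inner_conj_symm x y, RCLike.conj_mul]
  simp

/-- The Ky Fan inequality for a family of vectors `w i` in a finite-dimensional subspace with
`∑ w i ⊗ w i ≤ 1`, for an orthonormal basis that diagonalizes a positive operator. -/
theorem exists_subset_sum_energy_le {ι : Type*} {b : H →L[ℂ] H} (hb : 0 ≤ b) {n : ℕ}
    {ψ : Fin n → H} (hψ : Orthonormal ℂ ψ) {K : Submodule ℂ H}
    (hK : ∀ w ∈ K, ∑ l, ‖inner ℂ (ψ l) w‖ ^ 2 = ‖w‖ ^ 2 ∧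
      energy b w = ∑ l, ‖inner ℂ (ψ l) w‖ ^ 2 * energy b (ψ l))
    (S : Finset ι) (hS : S.card ≤ n) (w : ι → H) (hwK : ∀ i ∈ S, w i ∈ K)
    (hw : ∀ i ∈ S, ‖w i‖ ≤ 1) (hB : ∀ x : H, ∑ i ∈ S, ‖inner ℂ x (w i)‖ ^ 2 ≤ ‖x‖ ^ 2) :
    ∃ T : Finset (Fin n), T.card = S.card ∧
      ∑ i ∈ S, energy b (w i) ≤ ∑ l ∈ T, energy b (ψ l) := by
  -- The weight of `ψ l` is at most `1` by `hB` at `ψ l`; summing over `l` first bounds the total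
  -- mass by `∑ ‖w i‖² ≤ |S|`.
  obtain ⟨T, -, hT, h⟩ := exists_subset_sum_mul_le Finset.univ
    (fun l => ∑ i ∈ S, ‖inner ℂ (ψ l) (w i)‖ ^ 2) (fun l => energy b (ψ l))
    (fun l _ => energy_nonneg hb _) (fun l _ => Finset.sum_nonneg fun i _ => by positivity)
    (fun l _ => by simpa [hψ.1 l] using hB (ψ l)) S.card (by simpa using hS) (by
      rw [Finset.sum_comm]
      calc ∑ i ∈ S, ∑ l, ‖inner ℂ (ψ l) (w i)‖ ^ 2 ≤ ∑ i ∈ S, (1 : ℝ) :=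
            Finset.sum_le_sum fun i hi => by
              rw [(hK _ (hwK i hi)).1]
              exact pow_le_one₀ (norm_nonneg _) (hw i hi)
        _ = S.card := by simp)
  refine ⟨T, hT, le_trans (le_of_eq ?_) h⟩
  simp_rw [Finset.sum_mul]
  rw [Finset.sum_comm]
  exact Finset.sum_congr rfl fun i hi => (hK _ (hwK i hi)).2

/-! ### Projections of finite trace -/

theorem sum_rankOne_apply {ι : Type*} [Fintype ι] (x : ι → H) (z : H) :
    (∑ j, InnerProductSpace.rankOne ℂ (x j) (x j)) z = ∑ j, inner ℂ (x j) z • x j := by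
  simp

/-- Parseval for the pairs `x j`, `b (x j)` gives convergence and independence of the basis at once.
-/
theorem hasTrace_mul_sum_rankOne {ι : Type*} [Fintype ι] (b : H →L[ℂ] H) (x : ι → H) :
    HasTrace (b * ∑ j, InnerProductSpace.rankOne ℂ (x j) (x j)) (∑ j, inner ℂ (x j) (b (x j))) := by
  intro u
  have h := hasSum_sum (s := Finset.univ) fun j _ => u.hasSum_inner_mul_inner (x j) (b (x j))
  refine h.congr_fun fun i => ?_
  rw [mul_apply_eq_comp, sum_rankOne_apply, map_sum, inner_sum]
  exact Finset.sum_congr rfl fun j _ => by rw [map_smul, inner_smul_right]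

theorem hasTrace_sum_rankOne {ι : Type*} [Fintype ι] {x : ι → H} (hx : Orthonormal ℂ x) :
    HasTrace (∑ j, InnerProductSpace.rankOne ℂ (x j) (x j)) (Fintype.card ι : ℂ) := by
  have h := hasTrace_mul_sum_rankOne 1 x
  simpa [inner_self_eq_norm_sq_to_K, hx.1] using h

/-- A finite orthonormal family in the range of a projection of trace `k` has at most `k`
members. -/
theorem card_le_of_hasTrace (e : HilbertBasis ℕ ℂ H) {U : Submodule ℂ H}
    [U.HasOrthogonalProjection] {k : ℕ} (hk : HasTrace U.starProjection k) {ι : Type*} [Fintype ι]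
    {y : ι → H} (hy : Orthonormal ℂ y) (hyU : ∀ j, y j ∈ U) : Fintype.card ι ≤ k := by
  have h1 : HasSum (fun i => (inner ℂ (e i) (U.starProjection (e i))).re) (k : ℝ) := by
    simpa using Complex.hasSum_re (hk e)
  have h2 : HasSum (fun i => (inner ℂ (e i)
      ((∑ j, InnerProductSpace.rankOne ℂ (y j) (y j)) (e i))).re) (Fintype.card ι : ℝ) := by
    simpa using Complex.hasSum_re (hasTrace_sum_rankOne hy e)
  have h3 := hasSum_le (fun i => ?_) h2 h1
  · exact_mod_cast h3
  · have e1 : (inner ℂ (e i) (U.starProjection (e i))).re = ‖U.starProjection (e i)‖ ^ 2 := by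
      rw [← inner_conj_symm, Complex.conj_re]
      exact U.re_inner_starProjection_eq_normSq (e i)
    have e2 : (inner ℂ (e i) ((∑ j, InnerProductSpace.rankOne ℂ (y j) (y j)) (e i))).re =
        ∑ j, ‖inner ℂ (y j) (U.starProjection (e i))‖ ^ 2 := by
      rw [sum_rankOne_apply, inner_sum, Complex.re_sum]
      refine Finset.sum_congr rfl fun j _ => ?_
      rw [← U.inner_starProjection_left_eq_right, Submodule.starProjection_eq_self_iff.2 (hyU j),
        inner_smul_right, mul_comm, inner_mul_inner_symm, Complex.ofReal_re]
    rw [e1, e2]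
    exact hy.sum_inner_products_le _

section Complete

variable [CompleteSpace H]

theorem isSelfAdjoint_of_nonneg {b : H →L[ℂ] H} (hb : 0 ≤ b) : IsSelfAdjoint b :=
  ((ContinuousLinearMap.nonneg_iff_isPositive b).1 hb).isSelfAdjoint

theorem ofReal_energy {b : H →L[ℂ] H} (hb : IsSelfAdjoint b) (x : H) :
    (energy b x : ℂ) = inner ℂ x (b x) := by
  have h := ContinuousLinearMap.isSelfAdjoint_iff_isSymmetric.1 hb
  have := h.coe_re_inner_self_apply x
  simpa [energy] using this

/-- A self-adjoint operator is diagonalized, in the sense of quadratic forms, by an orthonormal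
basis of any given finite-dimensional subspace. -/
theorem exists_diagonalizing_orthonormal {b : H →L[ℂ] H} (hb : IsSelfAdjoint b)
    (K : Submodule ℂ H) [FiniteDimensional ℂ K] :
    ∃ ψ : Fin (Module.finrank ℂ K) → H, Orthonormal ℂ ψ ∧
      (∀ i j, i ≠ j → inner ℂ (ψ i) (b (ψ j)) = 0) ∧
      ∀ w ∈ K, ∑ l, ‖inner ℂ (ψ l) w‖ ^ 2 = ‖w‖ ^ 2 ∧
        energy b w = ∑ l, ‖inner ℂ (ψ l) w‖ ^ 2 * energy b (ψ l) := by
  -- The compression of `b` to `K`; its eigenbasis diagonalizes the form of `b` on `K`, although `K`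
  -- need not be invariant under `b`.
  let T : K →ₗ[ℂ] K := (K.orthogonalProjectionOnto ∘L b ∘L K.subtypeL : K →L[ℂ] K)
  have hin : ∀ x y : K, inner ℂ x (T y) = inner ℂ (x : H) (b y) := fun x y =>
    Submodule.inner_orthogonalProjectionOnto_eq_of_mem_left x (b y)
  have hbs := ContinuousLinearMap.isSelfAdjoint_iff_isSymmetric.1 hb
  have hT : T.IsSymmetric := fun x y => by
    rw [hin, ← inner_conj_symm, hin, inner_conj_symm]
    exact hbs x y
  set β := hT.eigenvectorBasis rfl with hβ
  have hTβ : ∀ l (w : K), inner ℂ (β l) (T w) = hT.eigenvalues rfl l * inner ℂ (β l) w := by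
    intro l w
    rw [← β.repr_apply_apply, ← β.repr_apply_apply]
    exact hT.eigenvectorBasis_apply_self_apply rfl w l
  have hEβ : ∀ l, energy b (β l : H) = hT.eigenvalues rfl l := by
    intro l
    rw [energy, ← hin, hTβ, inner_self_eq_norm_sq_to_K, β.orthonormal.1 l]
    simp
  refine ⟨fun l => β l, ⟨fun l => β.orthonormal.1 l, fun i j hij => β.orthonormal.2 hij⟩,
    fun i j hij => ?_, fun w hw => ⟨β.sum_sq_norm_inner_right ⟨w, hw⟩, ?_⟩⟩
  · rw [← hin, hTβ, β.orthonormal.2 hij, mul_zero]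
  · have h1 := β.sum_inner_mul_inner ⟨w, hw⟩ (T ⟨w, hw⟩)
    rw [energy, ← hin ⟨w, hw⟩ ⟨w, hw⟩, ← h1, Complex.re_sum]
    refine Finset.sum_congr rfl fun l _ => ?_
    rw [hTβ, hEβ, mul_left_comm, inner_mul_inner_symm, ← Complex.ofReal_mul, Complex.ofReal_re,
      mul_comm]
    rfl

theorem isStarProjection_sum_rankOne {ι : Type*} [Fintype ι] {x : ι → H} (hx : Orthonormal ℂ x) :
    IsStarProjection (∑ j, InnerProductSpace.rankOne ℂ (x j) (x j)) := by
  refine ⟨?_, isSelfAdjoint_sum _ fun j _ => InnerProductSpace.adjoint_rankOne _ _⟩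
  ext z
  rw [mul_apply_eq_comp, sum_rankOne_apply, sum_rankOne_apply]
  simp_rw [hx.inner_right_fintype]

theorem hasTrace_mul_sum_rankOne_energy {ι : Type*} [Fintype ι] {b : H →L[ℂ] H}
    (hb : IsSelfAdjoint b) (x : ι → H) :
    HasTrace (b * ∑ j, InnerProductSpace.rankOne ℂ (x j) (x j))
      ((∑ j, energy b (x j) : ℝ) : ℂ) := by
  simpa [ofReal_energy hb] using hasTrace_mul_sum_rankOne b x

/-- A finite trace forces finite rank, since orthonormal families in the range have at most `k`
members; the trace then equals the rank. -/
theorem exists_orthonormal_of_mem_projections (e : HilbertBasis ℕ ℂ H) {k : ℕ} {p : H →L[ℂ] H}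
    (hp : p ∈ projections (H := H) k) :
    ∃ x : Fin k → H, Orthonormal ℂ x ∧ p = ∑ j, InnerProductSpace.rankOne ℂ (x j) (x j) := by
  obtain ⟨hp1, hp2⟩ := hp
  obtain ⟨U, hU, rfl⟩ := isStarProjection_iff_eq_starProjection.1 hp1
  have hr : Module.rank ℂ U ≤ k := by
    refine rank_le fun s hs => ?_
    let L : Submodule ℂ U := Submodule.span ℂ (s : Set U)
    have : FiniteDimensional ℂ L := FiniteDimensional.span_finset ℂ s
    let β := stdOrthonormalBasis ℂ L
    have hβ : Orthonormal ℂ fun l => ((β l : U) : H) :=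
      ⟨fun l => β.orthonormal.1 l, fun i j hij => β.orthonormal.2 hij⟩
    have h := card_le_of_hasTrace e hp2 hβ fun l => (β l : U).2
    rwa [Fintype.card_fin, finrank_span_finset_eq_card hs] at h
  have : FiniteDimensional ℂ U :=
    Module.rank_lt_aleph0_iff.1 (hr.trans_lt (Cardinal.natCast_lt_aleph0))
  let β := stdOrthonormalBasis ℂ U
  have hβ : Orthonormal ℂ fun l => (β l : H) :=
    ⟨fun l => β.orthonormal.1 l, fun i j hij => β.orthonormal.2 hij⟩
  have hpβ := β.starProjection_eq_sum_rankOne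
  have hd : Module.finrank ℂ U = k := by
    have h1 := hasTrace_sum_rankOne hβ e
    rw [← hpβ] at h1
    simpa using h1.unique (hp2 e)
  subst hd
  exact ⟨_, hβ, hpβ⟩

theorem exists_projection_hasTrace_iff (e : HilbertBasis ℕ ℂ H) {b : H →L[ℂ] H}
    (hb : IsSelfAdjoint b) (k : ℕ) (t : ℝ) :
    (∃ p ∈ projections (H := H) k, HasTrace (b * p) t) ↔
      ∃ x : Fin k → H, Orthonormal ℂ x ∧ ∑ j, energy b (x j) = t := by
  constructor
  · rintro ⟨p, hp, ht⟩
    obtain ⟨x, hx, rfl⟩ := exists_orthonormal_of_mem_projections e hp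
    exact ⟨x, hx, by exact_mod_cast (hasTrace_mul_sum_rankOne_energy hb x e).unique (ht e)⟩
  · rintro ⟨x, hx, rfl⟩
    exact ⟨_, ⟨isStarProjection_sum_rankOne hx, by simpa using hasTrace_sum_rankOne hx⟩,
      hasTrace_mul_sum_rankOne_energy hb x⟩

theorem sum_energy_le_upperSum (e : HilbertBasis ℕ ℂ H) {b : H →L[ℂ] H} (hb : IsSelfAdjoint b)
    {ι : Type*} [Fintype ι] {x : ι → H} (hx : Orthonormal ℂ x) :
    ∑ j, energy b (x j) ≤ upperSum (Fintype.card ι) b := by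
  refine le_csSup ⟨Fintype.card ι * ‖b‖, ?_⟩
    ((exists_projection_hasTrace_iff e hb _ _).2 ⟨x ∘ (Fintype.equivFin ι).symm,
      hx.comp _ (Equiv.injective _), Equiv.sum_comp (Fintype.equivFin ι).symm fun j => energy b (x j)⟩)
  intro t ht
  obtain ⟨y, hy, rfl⟩ := (exists_projection_hasTrace_iff e hb _ _).1 ht
  calc ∑ j, energy b (y j) ≤ ∑ _j : Fin (Fintype.card ι), ‖b‖ :=
        Finset.sum_le_sum fun j _ => energy_le b (hy.1 j).le
    _ = _ := by simp

theorem sum_energy_le_upperSum_finset (e : HilbertBasis ℕ ℂ H) {b : H →L[ℂ] H}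
    (hb : IsSelfAdjoint b) {ι : Type*} {x : ι → H} (hx : Orthonormal ℂ x) (T : Finset ι) :
    ∑ j ∈ T, energy b (x j) ≤ upperSum T.card b := by
  have h := sum_energy_le_upperSum e hb (hx.comp ((↑) : T → ι) Subtype.val_injective)
  rw [Fintype.card_coe] at h
  rwa [← Finset.sum_coe_sort T]

theorem upperSum_le (e : HilbertBasis ℕ ℂ H) {b : H →L[ℂ] H} (hb : IsSelfAdjoint b) {k : ℕ} {C : ℝ}
    (h : ∀ x : Fin k → H, Orthonormal ℂ x → ∑ j, energy b (x j) ≤ C) : upperSum k b ≤ C := by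
  -- The real supremum needs a nonempty set: the first `k` basis vectors provide an element.
  refine csSup_le ⟨_, (exists_projection_hasTrace_iff e hb _ _).2 ⟨fun j : Fin k => e j,
    e.orthonormal.comp _ Fin.val_injective, rfl⟩⟩ fun t ht => ?_
  obtain ⟨x, hx, rfl⟩ := (exists_projection_hasTrace_iff e hb _ _).1 ht
  exact h x hx

theorem exists_lt_sum_energy (e : HilbertBasis ℕ ℂ H) {b : H →L[ℂ] H} (hb : IsSelfAdjoint b) (k : ℕ)
    {ε : ℝ} (hε : 0 < ε) :
    ∃ x : Fin k → H, Orthonormal ℂ x ∧ upperSum k b - ε ≤ ∑ j, energy b (x j) := by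
  by_contra! h
  have := upperSum_le e hb fun x hx => (h x hx).le
  linarith

end Complete

/-! ### Diagonal operators -/

theorem ext_hilbertBasis (e : HilbertBasis ℕ ℂ H) {a b : H →L[ℂ] H} (h : ∀ i, a (e i) = b (e i)) :
    a = b := by
  refine ContinuousLinearMap.ext_on (s := Set.range e) ?_ (by rintro _ ⟨i, rfl⟩; exact h i)
  rw [Submodule.dense_iff_topologicalClosure_eq_top]
  exact e.dense_span

theorem inner_basis_diagOp (e : HilbertBasis ℕ ℂ H) (f : lp (fun _ : ℕ => ℂ) ∞) (x : H) (i : ℕ) :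
    inner ℂ (e i) (diagOp e f x) = f i * inner ℂ (e i) x := by
  rw [← e.repr_apply_apply, ← e.repr_apply_apply]
  simp [diagOp, mulOp]

theorem norm_diagOp_le (e : HilbertBasis ℕ ℂ H) (f : lp (fun _ : ℕ => ℂ) ∞) :
    ‖diagOp e f‖ ≤ ‖f‖ := by
  refine ContinuousLinearMap.opNorm_le_bound _ (norm_nonneg _) fun x => ?_
  have h : ‖mulOp f‖ ≤ ‖f‖ := LinearMap.mkContinuous_norm_le _ (norm_nonneg _) _
  calc ‖diagOp e f x‖ = ‖mulOp f (e.repr x)‖ := by simp [diagOp]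
    _ ≤ ‖f‖ * ‖e.repr x‖ := (mulOp f).le_of_opNorm_le h _
    _ = ‖f‖ * ‖x‖ := by rw [e.repr.norm_map]

theorem diagOp_sub (e : HilbertBasis ℕ ℂ H) (f g : lp (fun _ : ℕ => ℂ) ∞) :
    diagOp e f - diagOp e g = diagOp e (f - g) := by
  refine ext_hilbertBasis e fun i => ?_
  simp [diagOp_apply_basis, sub_smul]

theorem diagSeq_apply (e : HilbertBasis ℕ ℂ H) (x : H →L[ℂ] H) (i : ℕ) :
    diagSeq e x i = inner ℂ (e i) (x (e i)) := rfl

theorem inner_diagOp_apply_basis (e : HilbertBasis ℕ ℂ H) (f : lp (fun _ : ℕ => ℂ) ∞) (i : ℕ) :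
    inner ℂ (e i) (diagOp e f (e i)) = f i := by
  rw [inner_basis_diagOp, inner_self_eq_norm_sq_to_K, e.orthonormal.1 i]
  simp

theorem energy_diagOp_apply_basis (e : HilbertBasis ℕ ℂ H) (f : lp (fun _ : ℕ => ℂ) ∞) (i : ℕ) :
    energy (diagOp e f) (e i) = (f i).re := by
  rw [energy, inner_diagOp_apply_basis]

theorem hasSum_energy_diagOp (e : HilbertBasis ℕ ℂ H) (f : lp (fun _ : ℕ => ℂ) ∞) (x : H) :
    HasSum (fun i => ‖inner ℂ (e i) x‖ ^ 2 * (f i).re) (energy (diagOp e f) x) := by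
  refine (Complex.hasSum_re (e.hasSum_inner_mul_inner x (diagOp e f x))).congr_fun fun i => ?_
  rw [inner_basis_diagOp, mul_left_comm, inner_mul_inner_symm, mul_comm (f i), Complex.re_ofReal_mul]

section Complete

variable [CompleteSpace H]

theorem isSelfAdjoint_diagOp (e : HilbertBasis ℕ ℂ H) {f : lp (fun _ : ℕ => ℂ) ∞}
    (hf : ∀ i, 0 ≤ f i) : IsSelfAdjoint (diagOp e f) := by
  refine ContinuousLinearMap.isSelfAdjoint_iff_isSymmetric.2 fun x y => ?_
  have h1 := e.hasSum_inner_mul_inner (diagOp e f x) y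
  refine h1.unique ((e.hasSum_inner_mul_inner x (diagOp e f y)).congr_fun fun i => ?_)
  have hfi : starRingEnd ℂ (f i) = f i := Complex.conj_eq_iff_im.2 (Complex.nonneg_iff.1 (hf i)).2.symm
  rw [inner_basis_diagOp, ← inner_conj_symm, inner_basis_diagOp, map_mul, hfi, inner_conj_symm]
  ring

/-- `U_k` of a positive diagonal operator is determined by the sums of `k` diagonal entries. -/
theorem upperSum_diagOp_le (e : HilbertBasis ℕ ℂ H) {f : lp (fun _ : ℕ => ℂ) ∞}
    (hf : ∀ i, 0 ≤ f i) {k : ℕ} {C : ℝ}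
    (h : ∀ S : Finset ℕ, S.card = k → ∑ i ∈ S, (f i).re ≤ C) : upperSum k (diagOp e f) ≤ C := by
  have hf' : ∀ i, 0 ≤ (f i).re := fun i => (Complex.nonneg_iff.1 (hf i)).1
  refine upperSum_le e (isSelfAdjoint_diagOp e hf) fun x hx => ?_
  refine hasSum_le_of_sum_le (hasSum_sum fun j _ => hasSum_energy_diagOp e f (x j)) fun G => ?_
  -- The partial sums are enlarged to at least `k` indices so that a `k`-subset exists.
  obtain ⟨G', hGG', hG'⟩ := Infinite.exists_superset_card_eq G (max k G.card) (le_max_right _ _)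
  obtain ⟨T, -, hT, hle⟩ := exists_subset_sum_mul_le G' (fun i => ∑ j, ‖inner ℂ (e i) (x j)‖ ^ 2)
    (fun i => (f i).re) (fun i _ => hf' i) (fun i _ => by positivity)
    (fun i _ => by
      have h1 := hx.sum_inner_products_le (s := Finset.univ) (e i)
      simp_rw [norm_inner_symm (e i)]
      simpa [e.orthonormal.1 i] using h1) k (by rw [hG']; exact le_max_left _ _)
    (by
      rw [Finset.sum_comm]
      calc ∑ j, ∑ i ∈ G', ‖inner ℂ (e i) (x j)‖ ^ 2 ≤ ∑ _j : Fin k, (1 : ℝ) :=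
            Finset.sum_le_sum fun j _ => by
              simpa [hx.1 j] using e.orthonormal.sum_inner_products_le (s := G') (x j)
        _ = k := by simp)
  calc ∑ i ∈ G, ∑ j, ‖inner ℂ (e i) (x j)‖ ^ 2 * (f i).re
      ≤ ∑ i ∈ G', ∑ j, ‖inner ℂ (e i) (x j)‖ ^ 2 * (f i).re :=
        Finset.sum_le_sum_of_subset_of_nonneg hGG' fun i _ _ =>
          Finset.sum_nonneg fun j _ => mul_nonneg (by positivity) (hf' i)
    _ = ∑ i ∈ G', (∑ j, ‖inner ℂ (e i) (x j)‖ ^ 2) * (f i).re := by simp_rw [Finset.sum_mul]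
    _ ≤ _ := hle
    _ ≤ C := h T hT

theorem submajorized_diagOp_iff (e : HilbertBasis ℕ ℂ H) {f : lp (fun _ : ℕ => ℂ) ∞}
    (hf : ∀ i, 0 ≤ f i) (b : H →L[ℂ] H) :
    Submajorized (diagOp e f) b ↔ ∀ S : Finset ℕ, ∑ i ∈ S, (f i).re ≤ upperSum S.card b := by
  constructor
  · intro h S
    refine le_trans ?_ (h S.card)
    simpa [energy_diagOp_apply_basis] using
      sum_energy_le_upperSum_finset e (isSelfAdjoint_diagOp e hf) e.orthonormal S
  · rintro h _
    exact upperSum_diagOp_le e hf (by rintro S rfl; exact h S)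

/-- The positive diagonal operators submajorized by `b`. -/
theorem submajorized_set_eq (e : HilbertBasis ℕ ℂ H) (b : H →L[ℂ] H) :
    {a : H →L[ℂ] H | ∃ f : lp (fun _ : ℕ => ℂ) ∞, (∀ i, 0 ≤ f i) ∧
        Submajorized (diagOp e f) b ∧ a = diagOp e f} =
      {a | (∀ i, a (e i) = inner ℂ (e i) (a (e i)) • e i) ∧ (∀ i, 0 ≤ inner ℂ (e i) (a (e i))) ∧
        ∀ S : Finset ℕ, ∑ i ∈ S, (inner ℂ (e i) (a (e i))).re ≤ upperSum S.card b} := by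
  ext a
  constructor
  · rintro ⟨f, hf, hs, rfl⟩
    simp only [Set.mem_ofPred_eq, inner_diagOp_apply_basis]
    exact ⟨diagOp_apply_basis e f, hf, (submajorized_diagOp_iff e hf b).1 hs⟩
  · rintro ⟨h1, h2, h3⟩
    exact ⟨diagSeq e a, h2, (submajorized_diagOp_iff e h2 b).2 h3,
      ext_hilbertBasis e fun i => by rw [diagOp_apply_basis]; exact h1 i⟩

/-- In terms of matrix entries, each condition involves only finitely many evaluations, continuous
in the operator. -/
theorem isClosed_submajorized_set (e : HilbertBasis ℕ ℂ H) (b : H →L[ℂ] H) :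
    IsClosed {a : H →L[ℂ] H | ∃ f : lp (fun _ : ℕ => ℂ) ∞, (∀ i, 0 ≤ f i) ∧
        Submajorized (diagOp e f) b ∧ a = diagOp e f} := by
  have hin : ∀ i, Continuous fun a : H →L[ℂ] H => inner ℂ (e i) (a (e i)) := fun i => by fun_prop
  rw [submajorized_set_eq]
  simp only [Set.ofPred_and, Set.ofPred_forall]
  refine IsClosed.inter ?_ (IsClosed.inter ?_ ?_)
  · exact isClosed_iInter fun i => isClosed_eq (by fun_prop) (by fun_prop)
  · exact isClosed_iInter fun i => isClosed_le continuous_const (hin i)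
  · exact isClosed_iInter fun S => isClosed_le
      (continuous_finsetSum _ fun i _ => Complex.continuous_re.comp (hin i)) continuous_const

/-! ### Diagonals of contractive conjugates are submajorized -/

theorem mem_contractions_iff {v : H →L[ℂ] H} : v ∈ contractions H ↔ ‖v‖ ≤ 1 := by
  rw [contractions, Set.mem_ofPred_eq,
    ← CStarAlgebra.norm_le_one_iff_of_nonneg (star v * v) (star_mul_self_nonneg v),
    CStarRing.norm_star_mul_self]
  constructor <;> intro h <;> nlinarith [norm_nonneg v]

theorem inner_conj_apply (v b : H →L[ℂ] H) (x : H) :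
    inner ℂ x ((v * b * star v) x) = inner ℂ (star v x) (b (star v x)) := by
  rw [mul_apply_eq_comp, mul_apply_eq_comp, ContinuousLinearMap.star_eq_adjoint,
    ContinuousLinearMap.adjoint_inner_left]

theorem sum_energy_star_le_upperSum (e : HilbertBasis ℕ ℂ H) {b : H →L[ℂ] H} (hb : 0 ≤ b)
    {v : H →L[ℂ] H} (hv : ‖v‖ ≤ 1) (S : Finset ℕ) :
    ∑ i ∈ S, energy b (star v (e i)) ≤ upperSum S.card b := by
  have hbs := isSelfAdjoint_of_nonneg hb
  -- The vectors `v* e_i` may be dependent; adding the `e_i` guarantees dimension at least `|S|`.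
  let K : Submodule ℂ H := Submodule.span ℂ ((fun i => star v (e i)) '' S) ⊔
    Submodule.span ℂ (e '' S)
  have : FiniteDimensional ℂ (Submodule.span ℂ ((fun i => star v (e i)) '' (S : Set ℕ))) :=
    FiniteDimensional.span_of_finite ℂ (S.finite_toSet.image _)
  have : FiniteDimensional ℂ (Submodule.span ℂ (e '' (S : Set ℕ))) :=
    FiniteDimensional.span_of_finite ℂ (S.finite_toSet.image _)
  have : FiniteDimensional ℂ K := Submodule.finiteDimensional_sup _ _
  have hcard : S.card ≤ Module.finrank ℂ K := by
    have hli : LinearIndependent ℂ (fun i : S => (⟨e i, (le_sup_right : _ ≤ K)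
        (Submodule.subset_span ⟨i, i.2, rfl⟩)⟩ : K)) := by
      refine LinearIndependent.of_comp K.subtype ?_
      exact e.orthonormal.linearIndependent.comp _ Subtype.val_injective
    simpa using hli.fintype_card_le_finrank
  obtain ⟨ψ, hψ, -, hK⟩ := exists_diagonalizing_orthonormal hbs K
  obtain ⟨T, hT, hle⟩ := exists_subset_sum_energy_le hb hψ hK S hcard (fun i => star v (e i))
    (fun i hi => (le_sup_left : _ ≤ K) (Submodule.subset_span ⟨i, hi, rfl⟩))
    (fun i _ => by
      have h := (star v).le_of_opNorm_le ((norm_star v).le.trans hv) (e i)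
      rwa [e.orthonormal.1 i, mul_one] at h)
    (fun x => by
      have h1 := e.orthonormal.sum_inner_products_le (s := S) (v x)
      have h2 : ‖v x‖ ≤ ‖x‖ := by simpa using v.le_of_opNorm_le hv x
      calc ∑ i ∈ S, ‖inner ℂ x (star v (e i))‖ ^ 2 = ∑ i ∈ S, ‖inner ℂ (e i) (v x)‖ ^ 2 :=
            Finset.sum_congr rfl fun i _ => by
              rw [ContinuousLinearMap.star_eq_adjoint, ContinuousLinearMap.adjoint_inner_right,
                norm_inner_symm]
        _ ≤ ‖v x‖ ^ 2 := h1
        _ ≤ ‖x‖ ^ 2 := by gcongr)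
  rw [← hT]
  exact hle.trans (sum_energy_le_upperSum_finset e hbs hψ T)

theorem diagExp_mem_submajorized_set (e : HilbertBasis ℕ ℂ H) {b : H →L[ℂ] H} (hb : 0 ≤ b)
    {v : H →L[ℂ] H} (hv : v ∈ contractions H) :
    ∃ f : lp (fun _ : ℕ => ℂ) ∞, (∀ i, 0 ≤ f i) ∧
      Submajorized (diagOp e f) b ∧ diagExp e (v * b * star v) = diagOp e f := by
  have h0 : ∀ i, 0 ≤ diagSeq e (v * b * star v) i := fun i => by
    rw [diagSeq_apply, inner_conj_apply]
    exact ((ContinuousLinearMap.nonneg_iff_isPositive b).1 hb).inner_nonneg_right _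
  refine ⟨_, h0, (submajorized_diagOp_iff e h0 b).2 fun S => ?_, rfl⟩
  simp_rw [diagSeq_apply, inner_conj_apply]
  exact sum_energy_star_le_upperSum e hb (mem_contractions_iff.1 hv) S

end Complete

/-! ### The essential maximum of the quadratic form -/

theorem exists_unit_mem_orthogonal (e : HilbertBasis ℕ ℂ H) (K : Submodule ℂ H)
    [FiniteDimensional ℂ K] : ∃ u ∈ Kᗮ, ‖u‖ = 1 := by
  have hne : Kᗮ ≠ ⊥ := fun h => by
    have hK : K = ⊤ := (Submodule.orthogonal_eq_bot_iff).1 h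
    have : FiniteDimensional ℂ H := by
      have h2 : FiniteDimensional ℂ (⊤ : Submodule ℂ H) := hK ▸ ‹FiniteDimensional ℂ K›
      exact Module.finite_def.2 ((Submodule.fg_iff_finiteDimensional _).2 h2)
    have : Finite ℕ := e.orthonormal.linearIndependent.finite
    exact not_finite ℕ
  obtain ⟨x, hx, hx0⟩ := Submodule.exists_mem_ne_zero_of_ne_bot hne
  refine ⟨((‖x‖⁻¹ : ℝ) : ℂ) • x, Kᗮ.smul_mem _ hx, ?_⟩
  rw [norm_smul, Complex.norm_real, norm_inv, norm_norm, inv_mul_cancel₀ (norm_ne_zero_iff.2 hx0)]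

/-- The maximum of the essential spectrum of a positive `b`, described through the quadratic form on
orthogonal complements of finite-dimensional subspaces. -/
theorem exists_essential_max (e : HilbertBasis ℕ ℂ H) {b : H →L[ℂ] H} (hb : 0 ≤ b) :
    ∃ α : ℝ, 0 ≤ α ∧
      (∀ ε > 0, ∀ K : Submodule ℂ H, FiniteDimensional ℂ K →
        ∃ u ∈ Kᗮ, ‖u‖ = 1 ∧ α - ε ≤ energy b u) ∧
      ∀ ε > 0, ∃ K : Submodule ℂ H, FiniteDimensional ℂ K ∧
        ∀ u ∈ Kᗮ, ‖u‖ = 1 → energy b u ≤ α + ε := by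
  -- Levels that the form reaches on unit vectors orthogonal to any finite-dimensional subspace; `α`
  -- is their supremum.
  set A : Set ℝ := {t | ∀ K : Submodule ℂ H, FiniteDimensional ℂ K →
    ∃ u ∈ Kᗮ, ‖u‖ = 1 ∧ t ≤ energy b u} with hA
  have h0 : (0 : ℝ) ∈ A := fun K hK => by
    obtain ⟨u, hu, hu1⟩ := exists_unit_mem_orthogonal e K
    exact ⟨u, hu, hu1, energy_nonneg hb u⟩
  have hbdd : BddAbove A := ⟨‖b‖, fun t ht => by
    obtain ⟨u, -, hu1, hle⟩ := ht ⊥ inferInstance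
    exact hle.trans (energy_le b hu1.le)⟩
  refine ⟨sSup A, le_csSup hbdd h0, fun ε hε K hK => ?_, fun ε hε => ?_⟩
  · obtain ⟨t, ht, hlt⟩ := exists_lt_of_lt_csSup ⟨0, h0⟩ (sub_lt_self (sSup A) hε)
    obtain ⟨u, hu, hu1, hle⟩ := ht K hK
    exact ⟨u, hu, hu1, hlt.le.trans hle⟩
  · have hn : sSup A + ε ∉ A := fun h => by linarith [le_csSup hbdd h]
    simp only [hA, Set.mem_ofPred_eq] at hn
    push Not at hn
    obtain ⟨K, hK, h⟩ := hn
    exact ⟨K, hK, fun u hu hu1 => (h u hu hu1).le⟩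

variable [CompleteSpace H]

/-! ### Finitely many large diagonal entries -/

theorem exists_orthonormalFinset_sub_le_energy (e : HilbertBasis ℕ ℂ H) {b : H →L[ℂ] H} (hb : 0 ≤ b)
    (F : Finset ℕ) (f : ℕ → ℝ) (hf : ∀ S ⊆ F, ∑ i ∈ S, f i ≤ upperSum S.card b) {ε : ℝ}
    (hε : 0 < ε) : ∃ u : ℕ → H, OrthonormalFinset F u ∧ ∀ i ∈ F, f i - ε ≤ energy b (u i) := by
  have hbs := isSelfAdjoint_of_nonneg hb
  choose x hx hxU using fun m => exists_lt_sum_energy e hbs m hε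
  -- Near-optimizers for every `U_m` with `m ≤ |F|`, so that one compression nearly attains all of
  -- them.
  set A : Set H := ⋃ m ∈ Finset.range (F.card + 1), Set.range (x m) with hA
  have hAfin : A.Finite := Set.Finite.biUnion (Finset.finite_toSet _) fun m _ => Set.finite_range _
  have hfd : FiniteDimensional ℂ (Submodule.span ℂ A) := FiniteDimensional.span_of_finite ℂ hAfin
  have hxA : ∀ m ≤ F.card, ∀ j, x m j ∈ Submodule.span ℂ A := fun m hm j =>
    Submodule.subset_span (Set.mem_biUnion (by simpa using Nat.lt_succ_of_le hm) ⟨j, rfl⟩)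
  have hcard : F.card ≤ Module.finrank ℂ (Submodule.span ℂ A) := by
    have hli : LinearIndependent ℂ fun j : Fin F.card =>
        (⟨x F.card j, hxA _ le_rfl j⟩ : Submodule.span ℂ A) :=
      LinearIndependent.of_comp (Submodule.span ℂ A).subtype (hx F.card).linearIndependent
    simpa using hli.fintype_card_le_finrank
  obtain ⟨ψ, hψ, hbψ, hK⟩ := exists_diagonalizing_orthonormal hbs (Submodule.span ℂ A)
  obtain ⟨u, -, hu, hle⟩ := exists_orthonormalFinset_le_energy hbs (fun i => f i - ε) F.card F
    Finset.univ ψ rfl (by simpa using hcard) ⟨fun i _ => hψ.1 i, fun i _ j _ hij => hψ.2 hij⟩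
    (fun i _ j _ hij => hbψ i j hij) (fun S hS => by
      -- The loss `ε` of the near-optimizer is absorbed by lowering each `f i` by `ε`, which needs
      -- at least one index.
      rcases S.eq_empty_or_nonempty with rfl | hne
      · exact ⟨∅, by simp, by simp, by simp⟩
      have hSF := Finset.card_le_card hS
      obtain ⟨T, hT, hTle⟩ := exists_subset_sum_energy_le hb hψ hK
        (Finset.univ : Finset (Fin S.card)) (by simpa using hSF.trans hcard) (x S.card)
        (fun j _ => hxA _ hSF j) (fun j _ => ((hx S.card).1 j).le) (fun z => by
          simp_rw [norm_inner_symm z]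
          exact (hx S.card).sum_inner_products_le z)
      refine ⟨T, Finset.subset_univ _, by simpa using hT, ?_⟩
      have h1 : (1 : ℝ) ≤ S.card := by exact_mod_cast hne.card_pos
      calc ∑ i ∈ S, (f i - ε) = ∑ i ∈ S, f i - S.card * ε := by simp [Finset.sum_sub_distrib]
        _ ≤ upperSum S.card b - ε := by nlinarith [hf S hS]
        _ ≤ _ := hxU S.card
        _ ≤ _ := hTle)
  exact ⟨u, hu, hle⟩

/-- If the quadratic form is at most `α` off a finite-dimensional subspace, then `U_m` grows at rate
at most `α`. -/
theorem upperSum_le_of_orthogonal (e : HilbertBasis ℕ ℂ H) {b : H →L[ℂ] H} (hb : 0 ≤ b)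
    (K : Submodule ℂ H) [FiniteDimensional ℂ K] {α : ℝ} (hα : 0 ≤ α)
    (hK : ∀ u ∈ Kᗮ, ‖u‖ = 1 → energy b u ≤ α) {δ : ℝ} (hδ : 0 < δ) (m : ℕ) :
    upperSum m b ≤ m * (α + ‖b‖ * δ) + ‖b‖ / δ * Module.finrank ℂ K := by
  have hbs := isSelfAdjoint_of_nonneg hb
  have hK' : ∀ y ∈ Kᗮ, ‖y‖ ≤ 1 → energy b y ≤ α := fun y hy hy1 => by
    rcases eq_or_ne y 0 with rfl | h0
    · simpa [energy] using hα
    have hn : ‖y‖ ≠ 0 := norm_ne_zero_iff.2 h0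
    have h1 := hK (((‖y‖⁻¹ : ℝ) : ℂ) • y) (Kᗮ.smul_mem _ hy) (by
      rw [norm_smul, Complex.norm_real, norm_inv, norm_norm, inv_mul_cancel₀ hn])
    rw [energy_smul, inv_pow, inv_mul_le_iff₀ (by positivity)] at h1
    exact h1.trans (mul_le_of_le_one_left hα (pow_le_one₀ (norm_nonneg _) hy1))
  -- Splitting `x` along `K` and `Kᗮ`, the terms involving the `K`-part are bounded by `2 ‖b‖ ‖p‖`,
  -- and AM-GM with parameter `δ` turns this into a small constant plus a multiple of `‖p‖²`, which
  -- is summable over orthonormal families.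
  have key : ∀ x : H, ‖x‖ = 1 →
      energy b x ≤ (α + ‖b‖ * δ) + ‖b‖ / δ * ‖K.starProjection x‖ ^ 2 := fun x hx => by
    set p := K.starProjection x with hp
    set q := x - p with hq
    have hqK : q ∈ Kᗮ := Submodule.sub_starProjection_mem_orthogonal x
    have hpyth : ‖x‖ ^ 2 = ‖p‖ ^ 2 + ‖q‖ ^ 2 := by
      have h := norm_add_sq_eq_norm_sq_add_norm_sq_of_inner_eq_zero (𝕜 := ℂ) p q
        (hqK p (Submodule.starProjection_apply_mem K x))
      rw [show p + q = x by rw [hq]; abel] at h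
      nlinarith
    have hq1 : ‖q‖ ≤ 1 := by
      rw [hx] at hpyth
      nlinarith [norm_nonneg q, sq_nonneg ‖p‖]
    have hsplit : energy b x = energy b q + ((inner ℂ p (b x)).re + (inner ℂ q (b p)).re) := by
      have hx' : x = q + p := by rw [hq]; abel
      have e1 : inner ℂ x (b x) = inner ℂ q (b q) + (inner ℂ p (b x) + inner ℂ q (b p)) := by
        nth_rewrite 1 [hx']
        rw [inner_add_left]
        nth_rewrite 1 [hx']
        rw [map_add, inner_add_right]
        ring
      rw [energy, energy, e1, Complex.add_re, Complex.add_re]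
    have hb1 : (inner ℂ p (b x)).re ≤ ‖b‖ * ‖p‖ := by
      calc (inner ℂ p (b x)).re ≤ ‖inner ℂ p (b x)‖ := Complex.re_le_norm _
        _ ≤ ‖p‖ * ‖b x‖ := norm_inner_le_norm _ _
        _ ≤ ‖p‖ * (‖b‖ * ‖x‖) := by gcongr; exact b.le_opNorm x
        _ = ‖b‖ * ‖p‖ := by rw [hx]; ring
    have hb2 : (inner ℂ q (b p)).re ≤ ‖b‖ * ‖p‖ := by
      calc (inner ℂ q (b p)).re ≤ ‖inner ℂ q (b p)‖ := Complex.re_le_norm _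
        _ ≤ ‖q‖ * ‖b p‖ := norm_inner_le_norm _ _
        _ ≤ 1 * (‖b‖ * ‖p‖) := by gcongr; exact b.le_opNorm p
        _ = ‖b‖ * ‖p‖ := one_mul _
    have hamgm : 2 * ‖p‖ ≤ δ + ‖p‖ ^ 2 / δ := by
      have h1 : 0 ≤ (‖p‖ - δ) ^ 2 / δ := by positivity
      have h2 : (‖p‖ - δ) ^ 2 / δ = ‖p‖ ^ 2 / δ - 2 * ‖p‖ + δ := by field_simp; ring
      linarith
    have h3 : ‖b‖ * (2 * ‖p‖) ≤ ‖b‖ * (δ + ‖p‖ ^ 2 / δ) := by gcongr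
    have h4 : ‖b‖ * (δ + ‖p‖ ^ 2 / δ) = ‖b‖ * δ + ‖b‖ / δ * ‖p‖ ^ 2 := by ring
    linarith [hK' q hqK hq1]
  refine upperSum_le e hbs fun x hx => ?_
  have hproj : ∑ j, ‖K.starProjection (x j)‖ ^ 2 ≤ Module.finrank ℂ K := by
    let β := stdOrthonormalBasis ℂ K
    have h1 : ∀ y : H, ‖K.starProjection y‖ ^ 2 = ∑ l, ‖inner ℂ y (β l : H)‖ ^ 2 := fun y => by
      have h := β.sum_sq_norm_inner_right (K.orthogonalProjectionOnto y)
      rw [Submodule.starProjection_apply, ← Submodule.coe_norm, ← h]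
      refine Finset.sum_congr rfl fun l _ => ?_
      rw [Submodule.inner_orthogonalProjectionOnto_eq_of_mem_left, norm_inner_symm]
    simp_rw [h1]
    rw [Finset.sum_comm]
    calc ∑ l, ∑ j, ‖inner ℂ (x j) (β l : H)‖ ^ 2
        ≤ ∑ _l : Fin (Module.finrank ℂ K), (1 : ℝ) := Finset.sum_le_sum fun l _ => by
          have h2 : ‖(β l : H)‖ = 1 := β.orthonormal.1 l
          simpa [h2] using hx.sum_inner_products_le (s := Finset.univ) (β l : H)
      _ = _ := by simp
  calc ∑ j, energy b (x j)
      ≤ ∑ j, ((α + ‖b‖ * δ) + ‖b‖ / δ * ‖K.starProjection (x j)‖ ^ 2) :=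
        Finset.sum_le_sum fun j _ => key _ (hx.1 j)
    _ = m * (α + ‖b‖ * δ) + ‖b‖ / δ * ∑ j, ‖K.starProjection (x j)‖ ^ 2 := by
        simp [Finset.sum_add_distrib, Finset.mul_sum, mul_add]
    _ ≤ _ := by gcongr

theorem finite_setOf_lt_of_sum_le_upperSum (e : HilbertBasis ℕ ℂ H) {b : H →L[ℂ] H} (hb : 0 ≤ b)
    {f : ℕ → ℝ} (hf : ∀ S : Finset ℕ, ∑ i ∈ S, f i ≤ upperSum S.card b) {α : ℝ} (hα : 0 ≤ α)
    {ε : ℝ} (hε : 0 < ε) (K : Submodule ℂ H) [FiniteDimensional ℂ K]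
    (hK : ∀ u ∈ Kᗮ, ‖u‖ = 1 → energy b u ≤ α) : {i | α + ε < f i}.Finite := by
  by_contra hinf
  -- Makes `‖b‖ δ ≤ ε / 2`, also for `b = 0`. With `m` large entries one would get `m (α + ε) ≤ m (α
  -- + ε / 2) + C`, false for large `m`.
  set δ : ℝ := ε / (2 * (‖b‖ + 1)) with hδ
  have hb0 := norm_nonneg b
  have hδ0 : 0 < δ := by positivity
  have hbδ : ‖b‖ * δ ≤ ε / 2 := by
    have h1 : (‖b‖ + 1) * δ = ε / 2 := by rw [hδ]; field_simp
    nlinarith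
  set C := ‖b‖ / δ * Module.finrank ℂ K with hC
  obtain ⟨m, hm⟩ := exists_nat_gt (C / (ε / 2))
  obtain ⟨S, hS, hcard⟩ := Set.Infinite.exists_subset_card_eq hinf m
  have h1 : m * (α + ε) ≤ ∑ i ∈ S, f i := by
    have := Finset.card_nsmul_le_sum S f (α + ε) fun i hi => le_of_lt (hS hi)
    rwa [hcard, nsmul_eq_mul] at this
  have h2 := hf S
  rw [hcard] at h2
  have h3 := upperSum_le_of_orthogonal e hb K hα hK hδ0 m
  rw [div_lt_iff₀ (by positivity)] at hm
  have h4 : (m : ℝ) * (‖b‖ * δ) ≤ m * (ε / 2) := by gcongr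
  linarith

/-! ### Construction of the contraction -/

theorem exists_orthonormal_sub_le_energy (e : HilbertBasis ℕ ℂ H) {b : H →L[ℂ] H} (hb : 0 ≤ b)
    {f : ℕ → ℝ} (hf : ∀ S : Finset ℕ, ∑ i ∈ S, f i ≤ upperSum S.card b) {ε : ℝ} (hε : 0 < ε) :
    ∃ u : ℕ → H, Orthonormal ℂ u ∧ ∀ i, f i - ε ≤ energy b (u i) := by
  obtain ⟨α, hα, hlow, hup⟩ := exists_essential_max e hb
  obtain ⟨K₀, _, hK₀⟩ := hup (ε / 4) (by positivity)
  have hfin := finite_setOf_lt_of_sum_le_upperSum e hb hf (by positivity) (by positivity : 0 < ε / 4)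
    K₀ hK₀
  set F := hfin.toFinset with hF
  have hFmem : ∀ i, i ∉ F → f i ≤ α + ε / 2 := fun i hi => by
    have : ¬ α + ε / 4 + ε / 4 < f i := fun h => hi (by simpa [hF] using h)
    linarith
  obtain ⟨u, hu, hule⟩ := exists_orthonormalFinset_sub_le_energy e hb F f (fun S _ => hf S) hε
  have hfd : FiniteDimensional ℂ (Submodule.span ℂ (u '' F)) :=
    FiniteDimensional.span_of_finite ℂ (F.finite_toSet.image _)
  -- Successive choice: each new vector is orthogonal to the vectors serving `F` and to all earlier
  -- choices. Off `F`, the bounds `f i ≤ α + ε / 2` and `α - ε / 2 ≤ energy b (y i)` leave exactly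
  -- the error `ε`.
  obtain ⟨y, hy, hyo⟩ := exists_seq_of_forall_finset_exists
    (fun z : H => z ∈ (Submodule.span ℂ (u '' F))ᗮ ∧ ‖z‖ = 1 ∧ α - ε / 2 ≤ energy b z)
    (fun z z' => inner ℂ z z' = 0) (fun s _ => by
      have : FiniteDimensional ℂ (Submodule.span ℂ (s : Set H)) := FiniteDimensional.span_finset ℂ s
      obtain ⟨z, hz, hz1, hzle⟩ := hlow (ε / 2) (by positivity)
        (Submodule.span ℂ (u '' F) ⊔ Submodule.span ℂ (s : Set H))
        (Submodule.finiteDimensional_sup _ _)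
      exact ⟨z, ⟨Submodule.orthogonal_le le_sup_left hz, hz1, hzle⟩, fun x hx =>
        hz x ((le_sup_right : Submodule.span ℂ (s : Set H) ≤ _) (Submodule.subset_span hx))⟩)
  have huy : ∀ i ∈ F, ∀ j, inner ℂ (u i) (y j) = 0 := fun i hi j =>
    (hy j).1 _ (Submodule.subset_span ⟨i, hi, rfl⟩)
  classical
  refine ⟨fun i => if i ∈ F then u i else y i, ⟨fun i => ?_, fun i j hij => ?_⟩, fun i => ?_⟩
  · by_cases h : i ∈ F
    · simpa [h] using hu.1 i h
    · simpa [h] using (hy i).2.1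
  · by_cases h : i ∈ F <;> by_cases h' : j ∈ F
    · simpa [h, h'] using hu.2 i h j h' hij
    · simpa [h, h'] using huy i h j
    · simpa [h, h'] using inner_eq_zero_symm.1 (huy j h' i)
    · simp only [h, h', if_false]
      rcases lt_or_gt_of_ne hij with hlt | hlt
      · exact hyo i j hlt
      · exact inner_eq_zero_symm.1 (hyo j i hlt)
  · by_cases h : i ∈ F
    · simpa [h] using hule i h
    · simp only [h, if_false]
      linarith [(hy i).2.2, hFmem i h]

/-- An orthonormal sequence, rescaled by a sequence of numbers in `[0, 1]`, is the image of the basis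
under a contraction. -/
theorem exists_contraction_apply_basis (e : HilbertBasis ℕ ℂ H) {u : ℕ → H} (hu : Orthonormal ℂ u)
    (c : ℕ → ℝ) (hc0 : ∀ i, 0 ≤ c i) (hc1 : ∀ i, c i ≤ 1) :
    ∃ w : H →L[ℂ] H, ‖w‖ ≤ 1 ∧ ∀ i, w (e i) = (c i : ℂ) • u i := by
  classical
  have hc : ∀ i, ‖(c i : ℂ)‖ ≤ 1 := fun i => by
    rw [Complex.norm_real, Real.norm_of_nonneg (hc0 i)]
    exact hc1 i
  let g : lp (fun _ : ℕ => ℂ) ∞ := ⟨fun i => (c i : ℂ), memℓp_infty ⟨1, by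
    rintro _ ⟨i, rfl⟩
    exact hc i⟩⟩
  have hg : ‖g‖ ≤ 1 := lp.norm_le_of_forall_le zero_le_one hc
  let W : H →ₗᵢ[ℂ] H := hu.orthogonalFamily.linearIsometry.comp e.repr.toLinearIsometry
  have hW : ∀ i, W (e i) = u i := fun i => by
    simp [W, e.repr_self]
  refine ⟨W.toContinuousLinearMap ∘L diagOp e g, ?_, fun i => ?_⟩
  · refine ContinuousLinearMap.opNorm_le_bound _ zero_le_one fun x => ?_
    calc ‖W (diagOp e g x)‖ = ‖diagOp e g x‖ := W.norm_map _
      _ ≤ 1 * ‖x‖ := (diagOp e g).le_of_opNorm_le ((norm_diagOp_le e g).trans hg) x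
  · change W (diagOp e g (e i)) = _
    rw [diagOp_apply_basis, map_smul, hW]

theorem exists_contraction_norm_sub_le (e : HilbertBasis ℕ ℂ H) {b : H →L[ℂ] H} (hb : 0 ≤ b)
    {f : lp (fun _ : ℕ => ℂ) ∞} (hf : ∀ i, 0 ≤ f i) (hfb : Submajorized (diagOp e f) b) {ε : ℝ}
    (hε : 0 < ε) :
    ∃ v ∈ contractions H, ‖diagOp e f - diagExp e (v * b * star v)‖ ≤ ε := by
  have hbs := isSelfAdjoint_of_nonneg hb
  have hf0 : ∀ i, 0 ≤ (f i).re := fun i => (Complex.nonneg_iff.1 (hf i)).1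
  obtain ⟨u, hu, hle⟩ := exists_orthonormal_sub_le_energy e hb
    ((submajorized_diagOp_iff e hf b).1 hfb) hε
  set q : ℕ → ℝ := fun i => energy b (u i) with hq
  have hq0 : ∀ i, 0 ≤ q i := fun i => energy_nonneg hb _
  -- Shrinks `u i` until the form takes the value `min (f i) (q i)`. If `q i = 0`, division by zero
  -- gives `c i = 0`, which is right because the minimum vanishes too.
  set c : ℕ → ℝ := fun i => √(min (f i).re (q i) / q i) with hc
  have hcq : ∀ i, c i ^ 2 * q i = min (f i).re (q i) := fun i => by
    rw [hc, Real.sq_sqrt (div_nonneg (le_min (hf0 i) (hq0 i)) (hq0 i))]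
    rcases (hq0 i).eq_or_lt with h | h
    · rw [← h, mul_zero, min_eq_right (hf0 i)]
    · exact div_mul_cancel₀ _ h.ne'
  obtain ⟨w, hw, hwe⟩ := exists_contraction_apply_basis e hu c (fun i => Real.sqrt_nonneg _)
    (fun i => Real.sqrt_le_one.2 (div_le_one_of_le₀ (min_le_right _ _) (hq0 i)))
  -- The diagonal of `v b v*` evaluates the form at `v* e_i`, so `v* = w` must send `e_i` to the
  -- rescaled `u i`.
  refine ⟨star w, mem_contractions_iff.2 ((norm_star w).le.trans hw), ?_⟩
  rw [diagExp, diagOp_sub]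
  refine (norm_diagOp_le e _).trans (lp.norm_le_of_forall_le hε.le fun i => ?_)
  have h1 : diagSeq e (star w * b * star (star w)) i = ((min (f i).re (q i) : ℝ) : ℂ) := by
    rw [diagSeq_apply, inner_conj_apply, star_star, hwe, ← ofReal_energy hbs, energy_smul, hcq]
  have h2 : f i = ((f i).re : ℂ) :=
    Complex.ext rfl (Complex.nonneg_iff.1 (hf i)).2.symm
  have h3 : (f - diagSeq e (star w * b * star (star w))) i =
      (((f i).re - min (f i).re (q i) : ℝ) : ℂ) := by
    rw [lp.coeFn_sub, Pi.sub_apply, h1, Complex.ofReal_sub, ← h2]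
  rw [h3, Complex.norm_real, Real.norm_of_nonneg (by linarith [min_le_left (f i).re (q i)])]
  have := hle i
  rcases min_cases (f i).re (q i) with ⟨h, _⟩ | ⟨h, _⟩ <;> rw [h] <;> linarith

end ContractiveSchurHorn

/-- A contractive Schur-Horn theorem for `B(H)`; the closure is in the operator norm. -/
theorem mainTheorem6 {H : Type*} [NormedAddCommGroup H] [InnerProductSpace ℂ H] [CompleteSpace H]
    (e : HilbertBasis ℕ ℂ H) (b : H →L[ℂ] H) (hb : 0 ≤ b) :
    closure {a : H →L[ℂ] H | ∃ v ∈ ContractiveSchurHorn.contractions H,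
        a = ContractiveSchurHorn.diagExp e (v * b * star v)} =
      {a : H →L[ℂ] H | ∃ f : lp (fun _ : ℕ => ℂ) ∞, (∀ i, 0 ≤ f i) ∧
        ContractiveSchurHorn.Submajorized (ContractiveSchurHorn.diagOp e f) b ∧
        a = ContractiveSchurHorn.diagOp e f} := by
  refine Set.Subset.antisymm
    (closure_minimal ?_ (ContractiveSchurHorn.isClosed_submajorized_set e b)) ?_
  · rintro _ ⟨v, hv, rfl⟩
    exact ContractiveSchurHorn.diagExp_mem_submajorized_set e hb hv
  · rintro _ ⟨f, hf, hfb, rfl⟩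
    refine Metric.mem_closure_iff.2 fun ε hε => ?_
    obtain ⟨v, hv, hle⟩ := ContractiveSchurHorn.exists_contraction_norm_sub_le e hb hf hfb
      (half_pos hε)
    exact ⟨_, ⟨v, hv, rfl⟩, by rw [dist_eq_norm]; linarith⟩
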